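/- **Theorem 2.** Let $\xi$ be a random variable with values in $\{0,1,2,\dots\}$, with $\mathbf{E}\{\xi\}=1$ and $\mathbf{P}\{\xi=1\}\neq 1$, and let $f(s)=\mathbf{E}\{s^\xi\}$ for $0\le s\le 1$ be its generating function. Let $T$ be the Bienaymé–Galton–Watson tree with offspring distribution $\xi$, that is, the random rooted tree in which the nodes have, independently of each other, numbers of children distributed as $\xi$. For each $n$ with $\mathbf{P}\{|T|=n\}>0$ let $T_n$ be $T$ conditioned on having exactly $n$ nodes, and let $I_n$ be the independence number of $T_n$, i.e. the largest size of a set of pairwise non-adjacent nodes. Then the equation $q=f(1-q)$ has exactly one solution $q$ in the interval $(1/2,1)$, and $$\frac{I_n}{n}\longrightarrow q\quad\text{in probability}$$ as $n\to\infty$ through the integers with $\mathbf{P}\{|T|=n\}>0$; that is, $\mathbf{P}\{|I_n/n-q|>\varepsilon\}\to 0$ for every $\varepsilon>0$. -/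

import Mathlib

open MeasureTheory ProbabilityTheory Filter Topology
open scoped ENNReal

/-- The generating function `f(s) = E{s^ξ}` of an offspring distribution `p` on `ℕ`. The series
converges absolutely for `0 ≤ s ≤ 1`. -/
noncomputable def offspringGenFun (p : PMF ℕ) (s : ℝ) : ℝ :=
  ∑' k : ℕ, (p k).toReal * s ^ k

/-- The rooted plane tree, in Ulam–Harris encoding, in which a node `u` has `c u` children.
The root is the empty word, the children of `u` are the words `u ++ [i]` with `i < c u`, and a word
belongs to the tree iff each of its letters is the label of an existing child of the preceding
prefix. (The values of `c` at words outside the tree play no role.) -/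
def ulamHarrisTree (c : List ℕ → ℕ) : Set (List ℕ) :=
  {v | ∀ (u : List ℕ) (i : ℕ), (u ++ [i]) <+: v → i < c u}

/-- The tree as a graph: its vertices are the nodes, its edges join each node to its children. -/
def ulamHarrisGraph (c : List ℕ → ℕ) : SimpleGraph (ulamHarrisTree c) :=
  SimpleGraph.fromRel fun v w => ∃ i : ℕ, (w : List ℕ) = (v : List ℕ) ++ [i]

/-- The event that the random tree with `ξ u ω` children at the node `u` has exactly `n` nodes
(in particular, that it is finite). -/
def treeSizeEvent {Ω : Type*} (ξ : List ℕ → Ω → ℕ) (n : ℕ) : Set Ω :=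
  {ω | (ulamHarrisTree fun u => ξ u ω).encard = (n : ℕ∞)}

/-- The independence number of the random tree with `ξ u ω` children at the node `u`. -/
noncomputable def treeIndepNum {Ω : Type*} (ξ : List ℕ → Ω → ℕ) (ω : Ω) : ℕ :=
  (ulamHarrisGraph fun u => ξ u ω).indepNum

/-! In a finite rooted tree the set of nodes with no child in the set, determined from the leaves
upwards, is a largest independent set (`indepNum_eq_card_kernel`). The independence number is thus a
sum over nodes of an indicator depending only on the subtree at each node, so it is compatible with
generating functions.

Give every node a factor `z` and every kernel node a further factor `x`. Let `A`, `B` be the total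
weights of the trees with root in, resp. not in the kernel. Then `A = z x f(B)` and `B = z (f(A+B) -
f(B))`, solved by `(q, 1-q)` at `z = x = 1`. For `x = exp(t s)` and `z = exp(-t (s q + ε))` with
small `t > 0`, a first-order perturbation of `(q, 1-q)` is a supersolution
(`exists_tilted_supersolution`), hence `A + B ≤ 1` (`tsum_treeProd_le_one`). A Chernoff bound with
`s = 1` and `s = -1` then makes the joint probability of size `n` and a deviation of order `n`
exponentially small (`exists_tsum_weight_le_pow`).

Conditioning divides by the probability of size `n`, which decays more slowly than any exponential
wherever it is nonzero (`exists_pow_le_sizeMass`). This needs no local limit theorem: grafting makes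
these probabilities supermultiplicative up to a factor `p 0`, and their generating function `Y = z
f(Y)` is infinite for every `z > 1`, since criticality gives `f(Y) ≥ Y`. -/

/-! ### Ulam–Harris trees and the kernel -/

theorem nil_mem_ulamHarrisTree (c : List ℕ → ℕ) : [] ∈ ulamHarrisTree c := by
  intro u i h
  simp at h

theorem cons_mem_ulamHarrisTree {c : List ℕ → ℕ} {i : ℕ} {w : List ℕ} :
    i :: w ∈ ulamHarrisTree c ↔ i < c [] ∧ w ∈ ulamHarrisTree fun u => c (i :: u) := by
  constructor
  · refine fun h => ⟨h [] i (by simp), fun u j hu => h (i :: u) j (by simpa using hu)⟩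
  · rintro ⟨h₁, h₂⟩ u j hu
    cases u with
    | nil =>
      obtain rfl : j = i := by simpa using hu
      exact h₁
    | cons k u =>
      obtain ⟨rfl, hu'⟩ := List.cons_prefix_cons.1 hu
      exact h₂ u j hu'

theorem concat_mem_ulamHarrisTree {c : List ℕ → ℕ} {v : List ℕ} {i : ℕ} :
    v ++ [i] ∈ ulamHarrisTree c ↔ v ∈ ulamHarrisTree c ∧ i < c v := by
  constructor
  · exact fun h => ⟨fun u j hu => h u j (hu.trans (List.prefix_append _ _)), h v i List.prefix_rfl⟩
  · rintro ⟨h₁, h₂⟩ u j hu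
    rcases List.prefix_concat_iff.1 (by simpa using hu) with h | h
    · obtain ⟨rfl, rfl⟩ : u = v ∧ j = i := by simpa using h
      exact h₂
    · exact h₁ u j h

theorem ulamHarrisTree_congr {c d : List ℕ → ℕ} (h : ∀ u ∈ ulamHarrisTree d, c u = d u) :
    ulamHarrisTree c = ulamHarrisTree d := by
  ext v
  induction v using List.reverseRecOn with
  | nil => simp [nil_mem_ulamHarrisTree]
  | append_singleton v i ih =>
    rw [concat_mem_ulamHarrisTree, concat_mem_ulamHarrisTree, ih]
    exact and_congr_right fun hv => by rw [h v hv]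

/-- The independence number of a finite graph of words joined to their one-letter extensions,
given its kernel: the set `K` of nodes none of whose children is in `K`. -/
theorem indepNum_eq_card_kernel (c : List ℕ → ℕ) (S K : Finset (List ℕ))
    (hS : ulamHarrisTree c = S) (hKS : K ⊆ S)
    (hK : ∀ v ∈ S, v ∈ K ↔ ∀ i, v ++ [i] ∈ S → v ++ [i] ∉ K) :
    (ulamHarrisGraph c).indepNum = K.card := by
  classical
  have hmem : ∀ v, v ∈ ulamHarrisTree c ↔ v ∈ S := fun v => by rw [hS]; simp
  have : Finite (ulamHarrisTree c) := by rw [hS]; exact S.finite_toSet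
  have : Fintype (ulamHarrisTree c) := Fintype.ofFinite _
  have hadj : ∀ v w : ulamHarrisTree c, (ulamHarrisGraph c).Adj v w ↔
      v ≠ w ∧ ((∃ i, w.1 = v.1 ++ [i]) ∨ ∃ i, v.1 = w.1 ++ [i]) := fun v w => by
    simp [ulamHarrisGraph, SimpleGraph.fromRel_adj]
  apply le_antisymm
  · obtain ⟨A, hA⟩ := (ulamHarrisGraph c).exists_isNIndepSet_indepNum
    rw [← hA.card_eq]
    have hind : ∀ v ∈ A, ∀ w ∈ A, ∀ i, w.1 ≠ v.1 ++ [i] := by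
      intro v hv w hw i hi
      have hne : v ≠ w := by
        rintro rfl
        simp at hi
      exact hA.isIndepSet hv hw hne ((hadj v w).2 ⟨hne, Or.inl ⟨i, hi⟩⟩)
    have hchild : ∀ v : ulamHarrisTree c, ∃ w ∈ K, w = (v : List ℕ) ∨ ∃ i, w = (v : List ℕ) ++ [i] := by
      intro v
      by_cases hv : (v : List ℕ) ∈ K
      · exact ⟨v, hv, Or.inl rfl⟩
      · have := (hK v ((hmem _).1 v.2)).not.1 hv
        push Not at this
        obtain ⟨i, -, hi⟩ := this
        exact ⟨_, hi, Or.inr ⟨i, rfl⟩⟩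
    -- `g` fixes the kernel nodes and moves any other node to a child in the kernel. A collision on
    -- the independent set `A` would give two nodes with a common child, hence equal, or a parent
    -- and a child both in `A`.
    choose g hgK hg using hchild
    refine Finset.card_le_card_of_injOn g (fun v _ => hgK v) ?_
    intro v hv w hw hvw
    apply Subtype.ext
    rcases hg v with h₁ | ⟨i, h₁⟩ <;> rcases hg w with h₂ | ⟨j, h₂⟩
    · rw [← h₁, ← h₂, hvw]
    · exact absurd (h₁.symm.trans (hvw.trans h₂)) (hind w hw v hv j)
    · exact absurd (h₂.symm.trans (hvw.symm.trans h₁)) (hind v hv w hw i)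
    · have := h₁.symm.trans (hvw.trans h₂)
      simpa using (List.append_inj' this rfl).1
  · have hind : (ulamHarrisGraph c).IsIndepSet
        (Finset.univ.filter fun v : ulamHarrisTree c => (v : List ℕ) ∈ K : Finset _) := by
      intro v hv w hw hne hvw
      simp only [Finset.coe_filter, Finset.mem_univ, true_and, Set.mem_ofPred_eq] at hv hw
      rcases ((hadj v w).1 hvw).2 with ⟨i, hi⟩ | ⟨i, hi⟩
      · exact (hK v (hKS hv)).1 hv i (hi ▸ hKS hw) (hi ▸ hw)
      · exact (hK w (hKS hw)).1 hw i (hi ▸ hKS hv) (hi ▸ hv)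
    refine le_trans (le_of_eq ?_) hind.card_le_indepNum
    symm
    refine Finset.card_bij (fun v _ => (v : List ℕ)) (fun v hv => by simpa using hv)
      (fun v _ w _ h => Subtype.ext h) fun v hv => ⟨⟨v, (hmem v).2 (hKS hv)⟩, by simpa using hv, rfl⟩

/-! ### Finite trees as an inductive type -/

/-- Finite plane forests: a nonempty forest consists of its first tree, given by the forest of
the subtrees at the children of the root, and of the remaining trees. A finite plane tree is
likewise identified with the forest of the subtrees at the children of its root. -/
inductive PlaneForest : Type
  | nil : PlaneForest
  | cons (a b : PlaneForest) : PlaneForest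

namespace PlaneForest

/-- The number of trees of a forest. -/
def len : PlaneForest → ℕ
  | nil => 0
  | cons _ b => b.len + 1

/-- The number of nodes of a forest. -/
def nodes : PlaneForest → ℕ
  | nil => 0
  | cons a b => a.nodes + 1 + b.nodes

/-- Whether the root of a tree lies in the kernel, i.e. has no child in the kernel. -/
def rootIn : PlaneForest → Bool
  | nil => true
  | cons a b => !a.rootIn && b.rootIn

/-- The forests of subtrees at the children of the nodes of a forest, in depth-first order. -/
def subforests : PlaneForest → List PlaneForest
  | nil => []
  | cons a b => (a :: a.subforests) ++ b.subforests

/-- Increase the first letter of a word. -/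
def shiftWord : List ℕ → List ℕ
  | [] => []
  | i :: v => (i + 1) :: v

/-- The nodes of a forest as words, in depth-first order. -/
def words : PlaneForest → List (List ℕ)
  | nil => []
  | cons a b => (([] :: a.words).map fun v => 0 :: v) ++ b.words.map shiftWord

/-- The forest of subtrees at the children of a node. -/
def sub : PlaneForest → List ℕ → PlaneForest
  | F, [] => F
  | nil, _ :: _ => nil
  | cons a _, 0 :: v => a.sub v
  | cons _ b, (i + 1) :: v => b.sub (i :: v)

/-- The offspring numbers of the nodes of a tree. -/
def deg (F : PlaneForest) (u : List ℕ) : ℕ := (F.sub u).len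

@[simp] theorem sub_nil (F : PlaneForest) : F.sub [] = F := by cases F <;> rfl

@[simp] theorem sub_cons_zero (a b : PlaneForest) (v : List ℕ) :
    (cons a b).sub (0 :: v) = a.sub v := rfl

@[simp] theorem sub_cons_succ (a b : PlaneForest) (i : ℕ) (v : List ℕ) :
    (cons a b).sub ((i + 1) :: v) = b.sub (i :: v) := rfl

/-- The nodes of the forest `F` are the non-root nodes of the tree that `F` encodes, whence the
exclusion of `[]`. -/
theorem mem_words {F : PlaneForest} {v : List ℕ} :
    v ∈ F.words ↔ v ≠ [] ∧ v ∈ ulamHarrisTree F.deg := by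
  induction F generalizing v with
  | nil =>
    cases v with
    | nil => simp [words]
    | cons i v => simp [words, cons_mem_ulamHarrisTree, deg, len]
  | cons a b iha ihb =>
    rcases v with _ | ⟨_ | i, v⟩
    · have : ∀ w ∈ b.words, shiftWord w ≠ [] := by
        rintro (_ | ⟨i, w⟩) hw
        · exact absurd rfl (ihb.1 hw).1
        · simp [shiftWord]
      simpa [words] using this
    · have h₁ : ∀ w, shiftWord w ≠ 0 :: v := by
        rintro (_ | ⟨i, w⟩) <;> simp [shiftWord]
      have h₂ : v ∈ ulamHarrisTree a.deg ↔ v = [] ∨ v ∈ a.words := by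
        rw [iha]
        rcases eq_or_ne v [] with rfl | h <;> simp [nil_mem_ulamHarrisTree, *]
      have h₃ : (fun u => (cons a b).deg (0 :: u)) = a.deg := rfl
      rw [cons_mem_ulamHarrisTree, h₃, h₂]
      simp [words, h₁, deg, len]
    · have h₁ : ∀ w, shiftWord w = (i + 1) :: v ↔ w = i :: v := by
        rintro (_ | ⟨i, w⟩) <;> simp [shiftWord]
      have h₃ : (fun u => (cons a b).deg ((i + 1) :: u)) = fun u => b.deg (i :: u) := rfl
      rw [cons_mem_ulamHarrisTree, h₃]
      have := @ihb (i :: v)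
      rw [cons_mem_ulamHarrisTree] at this
      simpa [words, h₁, deg, len] using this

theorem mem_cons_words {F : PlaneForest} {v : List ℕ} :
    v ∈ [] :: F.words ↔ v ∈ ulamHarrisTree F.deg := by
  rw [List.mem_cons, mem_words]
  rcases eq_or_ne v [] with rfl | h <;> simp [nil_mem_ulamHarrisTree, *]

theorem nodup_cons_words (F : PlaneForest) : ([] :: F.words).Nodup := by
  rw [List.nodup_cons]
  refine ⟨fun h => (mem_words.1 h).1 rfl, ?_⟩
  induction F with
  | nil => simp [words]
  | cons a b iha ihb =>
    have hinj : Function.Injective shiftWord := by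
      rintro (_ | ⟨i, v⟩) (_ | ⟨j, w⟩) <;> simp [shiftWord]
    have hnil : [] ∉ a.words := fun h => (mem_words.1 h).1 rfl
    rw [words, List.nodup_append]
    refine ⟨(List.nodup_cons.2 ⟨hnil, iha⟩).map fun v w h => by simpa using h, ihb.map hinj, ?_⟩
    intro v hv w hw
    obtain ⟨v, -, rfl⟩ := List.mem_map.1 hv
    obtain ⟨_ | ⟨i, w⟩, -, rfl⟩ := List.mem_map.1 hw <;> simp [shiftWord]

theorem map_sub_words (F : PlaneForest) : F.words.map F.sub = F.subforests := by
  induction F with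
  | nil => rfl
  | cons a b iha ihb =>
    have h₁ : (b.words.map shiftWord).map (cons a b).sub = b.words.map b.sub := by
      rw [List.map_map]
      refine List.map_congr_left ?_
      rintro (_ | ⟨i, v⟩) hv
      · exact absurd rfl (mem_words.1 hv).1
      · rfl
    have h₂ : (a.words.map fun v => 0 :: v).map (cons a b).sub = a.words.map a.sub := by
      rw [List.map_map]
      rfl
    rw [words, List.map_append, h₁, List.map_cons, List.map_cons, h₂, iha, ihb, subforests]
    simp

theorem map_sub_cons_words (F : PlaneForest) :
    ([] :: F.words).map F.sub = F :: F.subforests := by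
  rw [List.map_cons, map_sub_words, sub_nil]

theorem length_subforests (F : PlaneForest) : F.subforests.length = F.nodes := by
  induction F with
  | nil => rfl
  | cons a b iha ihb => simp [subforests, nodes, iha, ihb, add_right_comm]

theorem length_words (F : PlaneForest) : F.words.length = F.nodes := by
  rw [← length_subforests, ← map_sub_words, List.length_map]

theorem rootIn_sub_iff (F : PlaneForest) :
    F.rootIn = true ↔ ∀ i < F.len, (F.sub [i]).rootIn = false := by
  induction F with
  | nil => simp [rootIn, len]
  | cons a b _ ihb =>
    rw [rootIn, Bool.and_eq_true, ihb, len, Nat.forall_lt_succ_left]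
    simp

theorem sub_append (F : PlaneForest) (v w : List ℕ) : F.sub (v ++ w) = (F.sub v).sub w := by
  induction F generalizing v with
  | nil =>
    cases v with
    | nil => simp
    | cons i v => cases w <;> rfl
  | cons a b iha ihb =>
    rcases v with _ | ⟨_ | i, v⟩
    · simp
    · simpa using iha v
    · simpa using ihb (i :: v)

/-- The independence number of a tree: the size of its kernel. -/
def indep (F : PlaneForest) : ℕ := (F :: F.subforests).countP rootIn

/-! ### Finite Ulam–Harris trees correspond to plane forests -/

/-- The trees with offspring numbers `c` and `F.deg` coincide. -/
def Codes (F : PlaneForest) (c : List ℕ → ℕ) : Prop := ∀ u ∈ [] :: F.words, c u = F.deg u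

theorem Codes.ulamHarrisTree_eq {F : PlaneForest} {c : List ℕ → ℕ} (h : F.Codes c) :
    ulamHarrisTree c = (([] :: F.words).toFinset : Finset (List ℕ)) := by
  rw [ulamHarrisTree_congr fun u hu => h u (mem_cons_words.2 hu)]
  ext v
  rw [← mem_cons_words]
  simp

theorem Codes.encard_ulamHarrisTree {F : PlaneForest} {c : List ℕ → ℕ} (h : F.Codes c) :
    (ulamHarrisTree c).encard = (F.nodes + 1 : ℕ) := by
  rw [h.ulamHarrisTree_eq, Set.encard_coe_eq_coe_finsetCard,
    List.toFinset_card_of_nodup F.nodup_cons_words, List.length_cons, length_words]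

theorem Codes.indepNum_eq {F : PlaneForest} {c : List ℕ → ℕ} (h : F.Codes c) :
    (ulamHarrisGraph c).indepNum = F.indep := by
  rw [indepNum_eq_card_kernel c ([] :: F.words).toFinset
    ((([] :: F.words).filter fun v => (F.sub v).rootIn).toFinset) h.ulamHarrisTree_eq]
  · rw [List.toFinset_card_of_nodup (F.nodup_cons_words.filter _), ← List.countP_eq_length_filter,
      indep, ← map_sub_cons_words, List.countP_map]
    rfl
  · intro v hv
    simp only [List.mem_toFinset, List.mem_filter] at hv ⊢
    exact hv.1
  · intro v hv
    simp only [List.mem_toFinset, List.mem_filter, mem_cons_words] at hv ⊢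
    rw [rootIn_sub_iff]
    constructor
    · rintro ⟨-, hv'⟩ i hi ⟨-, hi'⟩
      have := hv' i (concat_mem_ulamHarrisTree.1 hi).2
      rw [← sub_append] at this
      simp [this] at hi'
    · refine fun hv' => ⟨hv, fun i hi => ?_⟩
      have hi := concat_mem_ulamHarrisTree.2 ⟨hv, hi⟩
      have := hv' i hi
      rw [← sub_append]
      simpa [hi] using this

/-- Prescribing the number of trees separately, rather than as `c []`, lets the induction pass to
the remaining trees of a forest, which have no root of their own. -/
theorem eq_of_words_agree {F G : PlaneForest} (c : List ℕ → ℕ) (hlen : F.len = G.len)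
    (hF : ∀ u ∈ F.words, c u = F.deg u) (hG : ∀ u ∈ G.words, c u = G.deg u) : F = G := by
  induction F generalizing G c with
  | nil =>
    cases G with
    | nil => rfl
    | cons a b => simp [len] at hlen
  | cons a b iha ihb =>
    cases G with
    | nil => simp [len] at hlen
    | cons a' b' =>
      have key : ∀ {a b : PlaneForest}, (∀ u ∈ (cons a b).words, c u = (cons a b).deg u) →
          c [0] = a.len ∧ (∀ u ∈ a.words, c (0 :: u) = a.deg u) ∧
            ∀ u ∈ b.words, c (shiftWord u) = b.deg u := by
        intro a b h
        refine ⟨?_, fun u hu => h _ (by simp [words, hu]), fun u hu => ?_⟩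
        · rw [h [0] (by simp [words])]
          simp [deg]
        · rw [h (shiftWord u) (by
            rw [words, List.mem_append]
            exact Or.inr (List.mem_map_of_mem hu))]
          rcases u with _ | ⟨i, u⟩
          · exact absurd rfl (mem_words.1 hu).1
          · rfl
      obtain ⟨h₁, h₂, h₃⟩ := key hF
      obtain ⟨h₁', h₂', h₃'⟩ := key hG
      rw [iha (fun u => c (0 :: u)) (h₁.symm.trans h₁') h₂ h₂',
        ihb (fun u => c (shiftWord u)) (by simpa [len] using hlen) h₃ h₃']

theorem Codes.unique {F G : PlaneForest} {c : List ℕ → ℕ} (hF : F.Codes c) (hG : G.Codes c) :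
    F = G := by
  refine eq_of_words_agree c ?_ (fun u hu => hF u (by simp [hu])) fun u hu => hG u (by simp [hu])
  have h₁ := hF [] (by simp)
  have h₂ := hG [] (by simp)
  simpa [deg] using h₁.symm.trans h₂

theorem exists_words_agree (c : List ℕ → ℕ) (k : ℕ)
    (hfin : {w | ∃ i v, w = i :: v ∧ i < k ∧ v ∈ ulamHarrisTree fun u => c (i :: u)}.Finite) :
    ∃ F : PlaneForest, F.len = k ∧ ∀ u ∈ F.words, c u = F.deg u := by
  induction hn : Set.ncard {w | ∃ i v, w = i :: v ∧ i < k ∧ v ∈ ulamHarrisTree fun u => c (i :: u)}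
    using Nat.strong_induction_on generalizing c k with
  | _ n ih =>
  subst hn
  cases k with
  | zero => exact ⟨nil, rfl, by simp [words]⟩
  | succ k =>
    set D := {w | ∃ i v, w = i :: v ∧ i < k + 1 ∧ v ∈ ulamHarrisTree fun u => c (i :: u)} with hD
    have hroot : [0] ∈ D := ⟨0, [], rfl, k.succ_pos, nil_mem_ulamHarrisTree _⟩
    -- The forest below the first root and the forest of remaining trees both embed in `D` avoiding
    -- the node `[0]`, so both are strictly smaller.
    have key : ∀ (E : Set (List ℕ)) (g : List ℕ → List ℕ), Function.Injective g →
        (∀ w ∈ E, g w ∈ D ∧ g w ≠ [0]) → E.Finite ∧ E.ncard < D.ncard := by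
      intro E g hg hE
      have hsub : g '' E ⊆ D := by
        rintro _ ⟨w, hw, rfl⟩
        exact (hE w hw).1
      refine ⟨(hfin.subset hsub).of_finite_image hg.injOn, ?_⟩
      rw [← Set.ncard_image_of_injective E hg]
      refine Set.ncard_lt_ncard ⟨hsub, fun h => ?_⟩ hfin
      obtain ⟨w, hw, hw'⟩ := h hroot
      exact (hE w hw).2 hw'
    obtain ⟨hfa, hca⟩ := key {w | ∃ i v, w = i :: v ∧ i < c [0] ∧
        v ∈ ulamHarrisTree fun u => c (0 :: i :: u)} (fun v => 0 :: v)
      (fun v w h => by simpa using h) (by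
        rintro _ ⟨i, v, rfl, hi, hv⟩
        exact ⟨⟨0, i :: v, rfl, k.succ_pos, cons_mem_ulamHarrisTree.2 ⟨hi, hv⟩⟩, by simp⟩)
    obtain ⟨hfb, hcb⟩ := key {w | ∃ i v, w = i :: v ∧ i < k ∧
        v ∈ ulamHarrisTree fun u => c (shiftWord (i :: u))} shiftWord
      (by rintro (_ | ⟨i, v⟩) (_ | ⟨j, w⟩) <;> simp [shiftWord]) (by
        rintro _ ⟨i, v, rfl, hi, hv⟩
        exact ⟨⟨i + 1, v, rfl, Nat.succ_lt_succ hi, hv⟩, by simp [shiftWord]⟩)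
    obtain ⟨a, hal, ha⟩ := ih _ hca (fun u => c (0 :: u)) (c [0]) hfa rfl
    obtain ⟨b, hbl, hb⟩ := ih _ hcb (fun u => c (shiftWord u)) k hfb rfl
    refine ⟨cons a b, by rw [len, hbl], fun u hu => ?_⟩
    simp only [words, List.mem_append, List.mem_map, List.mem_cons] at hu
    rcases hu with ⟨v, rfl | hv, rfl⟩ | ⟨_ | ⟨i, v⟩, hv, rfl⟩
    · simpa [deg] using hal.symm
    · exact ha v hv
    · exact absurd rfl (mem_words.1 hv).1
    · exact hb _ hv

theorem exists_codes {c : List ℕ → ℕ} (h : (ulamHarrisTree c).Finite) :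
    ∃ F : PlaneForest, F.Codes c := by
  obtain ⟨F, hl, hF⟩ := exists_words_agree c (c []) (h.subset (by
    rintro _ ⟨i, v, rfl, hi, hv⟩
    exact cons_mem_ulamHarrisTree.2 ⟨hi, hv⟩))
  refine ⟨F, fun u hu => ?_⟩
  rcases List.mem_cons.1 hu with rfl | hu
  · simpa [deg] using hl.symm
  · exact hF u hu

instance : Countable PlaneForest := by
  let e : PlaneForest → ℕ := fun F => F.rec 0 fun _ _ x y => Nat.pair x y + 1
  refine Function.Injective.countable (f := e) fun F => ?_
  induction F with
  | nil =>
    rintro (_ | ⟨a, b⟩) h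
    · rfl
    · exact absurd h (Nat.succ_ne_zero _).symm
  | cons a b iha ihb =>
    rintro (_ | ⟨a', b'⟩) h
    · exact absurd h (Nat.succ_ne_zero _)
    · have h' : Nat.pair (e a) (e b) = Nat.pair (e a') (e b') := Nat.succ_injective h
      rw [Nat.pair_eq_pair] at h'
      rw [iha h'.1, ihb h'.2]

/-! ### Law of the random tree -/

/-- The probability that the branching tree with offspring distribution `p` is the tree `F`. -/
noncomputable def weight (p : PMF ℕ) (F : PlaneForest) : ℝ≥0∞ :=
  ((F :: F.subforests).map fun G => p G.len).prod

theorem setOf_codes_eq {Ω : Type*} (ξ : List ℕ → Ω → ℕ) (F : PlaneForest) : {ω | F.Codes fun u => ξ u ω} =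
    ⋂ u ∈ ([] :: F.words).toFinset, ξ u ⁻¹' {F.deg u} := by
  ext ω
  simp [Codes]

theorem treeSizeEvent_eq {Ω : Type*} (ξ : List ℕ → Ω → ℕ) (n : ℕ) :
    treeSizeEvent ξ n = ⋃ F ∈ {F : PlaneForest | F.nodes + 1 = n}, {ω | F.Codes fun u => ξ u ω} := by
  ext ω
  simp only [treeSizeEvent, Set.mem_ofPred_eq, Set.mem_iUnion, exists_prop]
  constructor
  · intro h
    obtain ⟨F, hF⟩ := exists_codes (Set.finite_of_encard_eq_coe h)
    refine ⟨F, ?_, hF⟩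
    rw [hF.encard_ulamHarrisTree] at h
    exact_mod_cast h
  · rintro ⟨F, rfl, hF⟩
    exact hF.encard_ulamHarrisTree

section Probability

variable {Ω : Type*} [MeasurableSpace Ω] {P : Measure Ω} {p : PMF ℕ} {ξ : List ℕ → Ω → ℕ}

theorem measurableSet_codes (hmeas : ∀ u, Measurable (ξ u)) (F : PlaneForest) :
    MeasurableSet {ω | F.Codes fun u => ξ u ω} := by
  rw [setOf_codes_eq]
  exact Finset.measurableSet_biInter _ fun u _ => hmeas u (measurableSet_singleton _)

theorem measure_codes (hmeas : ∀ u, Measurable (ξ u)) (hlaw : ∀ u, P.map (ξ u) = p.toMeasure)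
    (hindep : iIndepFun ξ P) (F : PlaneForest) :
    P {ω | F.Codes fun u => ξ u ω} = F.weight p := by
  rw [setOf_codes_eq, hindep.measure_inter_preimage_eq_mul _
    fun u _ => measurableSet_singleton (F.deg u)]
  have h : ∀ u, P (ξ u ⁻¹' {F.deg u}) = p (F.sub u).len := by
    intro u
    rw [← Measure.map_apply (hmeas u) (measurableSet_singleton _), hlaw,
      PMF.toMeasure_apply_singleton _ _ (measurableSet_singleton _), deg]
  simp_rw [h]
  rw [List.prod_toFinset _ F.nodup_cons_words, weight, ← map_sub_cons_words, List.map_map]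
  rfl

theorem measurableSet_treeSizeEvent (hmeas : ∀ u, Measurable (ξ u)) (n : ℕ) :
    MeasurableSet (treeSizeEvent ξ n) := by
  rw [treeSizeEvent_eq]
  exact MeasurableSet.biUnion (Set.to_countable _) fun F _ => measurableSet_codes hmeas F

theorem measure_treeSizeEvent (hmeas : ∀ u, Measurable (ξ u))
    (hlaw : ∀ u, P.map (ξ u) = p.toMeasure) (hindep : iIndepFun ξ P) (n : ℕ) :
    P (treeSizeEvent ξ n) = ∑' F : {F : PlaneForest | F.nodes + 1 = n}, F.1.weight p := by
  rw [treeSizeEvent_eq, measure_biUnion (Set.to_countable _) _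
    fun F _ => measurableSet_codes hmeas F]
  · simp_rw [measure_codes hmeas hlaw hindep]
  · intro F _ G _ hne
    exact Set.disjoint_left.2 fun ω hF hG => hne (Codes.unique hF hG)

theorem measure_treeSizeEvent_inter_le (hmeas : ∀ u, Measurable (ξ u))
    (hlaw : ∀ u, P.map (ξ u) = p.toMeasure) (hindep : iIndepFun ξ P) (n : ℕ) (Q : ℕ → Prop) :
    P (treeSizeEvent ξ n ∩ {ω | Q (treeIndepNum ξ ω)}) ≤
      ∑' F : {F : PlaneForest | F.nodes + 1 = n ∧ Q F.indep}, F.1.weight p := by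
  have hsub : treeSizeEvent ξ n ∩ {ω | Q (treeIndepNum ξ ω)} ⊆
      ⋃ F ∈ {F : PlaneForest | F.nodes + 1 = n ∧ Q F.indep}, {ω | F.Codes fun u => ξ u ω} := by
    rw [treeSizeEvent_eq]
    rintro ω ⟨h, hQ⟩
    simp only [Set.mem_iUnion, Set.mem_ofPred_eq, exists_prop] at h hQ ⊢
    obtain ⟨F, hn, hF⟩ := h
    rw [treeIndepNum, hF.indepNum_eq] at hQ
    exact ⟨F, ⟨hn, hQ⟩, hF⟩
  refine (measure_mono hsub).trans ((measure_biUnion_le _ (Set.to_countable _) _).trans_eq ?_)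
  simp_rw [measure_codes hmeas hlaw hindep]

end Probability

/-! ### Generating functions of trees and forests -/

/-- The decomposition of a nonempty forest into its first tree and the remaining trees. -/
def equivSum : PlaneForest ≃ Unit ⊕ PlaneForest × PlaneForest where
  toFun
    | nil => Sum.inl ()
    | cons a b => Sum.inr (a, b)
  invFun
    | Sum.inl _ => nil
    | Sum.inr x => cons x.1 x.2
  left_inv F := by cases F <;> rfl
  right_inv x := by rcases x with _ | ⟨a, b⟩ <;> rfl

theorem tsum_eq_nil_add (φ : PlaneForest → ℝ≥0∞) :
    ∑' F, φ F = φ nil + ∑' a, ∑' b, φ (cons a b) := by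
  rw [← equivSum.symm.tsum_eq]
  have h := HasSum.sum (f := fun x => φ (equivSum.symm x)) (a := φ nil)
    (b := ∑' x : PlaneForest × PlaneForest, φ (cons x.1 x.2))
    (hasSum_unique (f := fun _ : Unit => φ nil)) ENNReal.summable.hasSum
  rw [h.tsum_eq, ENNReal.tsum_prod']

/-- The product of the values of `g` at the trees of a forest. -/
noncomputable def forestProd (g : PlaneForest → ℝ≥0∞) : PlaneForest → ℝ≥0∞
  | nil => 1
  | cons a b => g a * forestProd g b

/-- A forest of `k` trees is a `k`-tuple of trees, and the sum of a product over tuples factorises.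
-/
theorem tsum_forestProd_len (g : PlaneForest → ℝ≥0∞) (k : ℕ) :
    ∑' F, (if F.len = k then forestProd g F else 0) = (∑' F, g F) ^ k := by
  induction k with
  | zero =>
    rw [tsum_eq_nil_add]
    simp [len, forestProd]
  | succ k ih =>
    rw [tsum_eq_nil_add, pow_succ', ← ENNReal.tsum_mul_right]
    simp only [len, forestProd, add_left_inj, ← ih, ← ENNReal.tsum_mul_left, mul_ite, mul_zero]
    simp

theorem tsum_len_mul_forestProd (c : ℕ → ℝ≥0∞) (g : PlaneForest → ℝ≥0∞) :
    ∑' F, c F.len * forestProd g F = ∑' k, c k * (∑' F, g F) ^ k := by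
  simp_rw [← tsum_forestProd_len, ← ENNReal.tsum_mul_left]
  rw [ENNReal.tsum_comm]
  refine tsum_congr fun F => ?_
  rw [tsum_eq_single F.len fun k hk => by simp [hk.symm]]
  simp

/-- The product of the values of `h` over the nodes of a tree. -/
noncomputable def treeProd (h : PlaneForest → ℝ≥0∞) (F : PlaneForest) : ℝ≥0∞ :=
  ((F :: F.subforests).map h).prod

theorem treeProd_eq (h : PlaneForest → ℝ≥0∞) (F : PlaneForest) :
    treeProd h F = h F * forestProd (treeProd h) F := by
  have : ∀ F : PlaneForest, (F.subforests.map h).prod = forestProd (treeProd h) F := by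
    intro F
    induction F with
    | nil => simp [subforests, forestProd]
    | cons a b _ ihb => rw [subforests, List.map_append, List.prod_append, ihb, forestProd, treeProd]
  rw [treeProd, List.map_cons, List.prod_cons, this]

theorem weight_eq_treeProd (p : PMF ℕ) (F : PlaneForest) :
    F.weight p = treeProd (fun G => p G.len) F := rfl

theorem treeProd_weighted (p : PMF ℕ) (z x : ℝ≥0∞) (F : PlaneForest) :
    treeProd (fun G => p G.len * z * if G.rootIn then x else 1) F =
      F.weight p * z ^ (F.nodes + 1) * x ^ F.indep := by
  have : ∀ l : List PlaneForest,
      (l.map fun G => p G.len * z * if G.rootIn then x else 1).prod =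
        (l.map fun G => p G.len).prod * z ^ l.length * x ^ l.countP rootIn := by
    intro l
    induction l with
    | nil => simp
    | cons G l ih =>
      rw [List.map_cons, List.prod_cons, ih, List.map_cons, List.prod_cons, List.length_cons,
        List.countP_cons]
      cases G.rootIn
      · simp only [Bool.false_eq_true, if_false, pow_succ, add_zero]
        ring
      · simp only [if_true, pow_succ]
        ring
  rw [treeProd, this, List.length_cons, length_subforests, weight, indep]

/-- The polynomial `(A + B) ^ k - B ^ k` is nondecreasing in both variables and equals `1 - b ^ k`
at `(a, b)`. The additive form avoids truncated subtraction. -/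
theorem pow_add_pow_le_one_add_pow {A B a b : ℝ≥0∞} (hA : A ≤ a) (hB : B ≤ b) (hab : a + b = 1)
    (k : ℕ) : (A + B) ^ k + b ^ k ≤ 1 + B ^ k := by
  have ha : a ≠ ∞ := fun h => by simp [h] at hab
  have hb : b ≠ ∞ := fun h => by simp [h] at hab
  lift A to NNReal using ne_top_of_le_ne_top ha hA
  lift B to NNReal using ne_top_of_le_ne_top hb hB
  lift a to NNReal using ha
  lift b to NNReal using hb
  have hA : (A : ℝ) ≤ a := by exact_mod_cast hA
  have hB : (B : ℝ) ≤ b := by exact_mod_cast hB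
  have hab : (a + b : ℝ) = 1 := by exact_mod_cast hab
  have key : ((A : ℝ) + B) ^ k + b ^ k ≤ 1 + B ^ k := by
    induction k with
    | zero => simp
    | succ k ih =>
      have hb1 : (b : ℝ) ≤ 1 := by linarith [a.coe_nonneg]
      have h₁ : (b : ℝ) * (b ^ k - B ^ k) ≤ b ^ k - B ^ k :=
        mul_le_of_le_one_left (sub_nonneg.2 (by gcongr)) hb1
      have h₂ : (B : ℝ) ^ k * (b - B) ≤ (A + B : ℝ) ^ k * (1 - (A + B)) := by
        have hA0 := A.coe_nonneg
        exact mul_le_mul (pow_le_pow_left₀ B.coe_nonneg (by linarith) k) (by linarith)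
          (by linarith) (by positivity)
      simp only [pow_succ]
      linarith
  exact_mod_cast key

/-- If `(a, b)` is a supersolution of the equations for the generating functions of the trees
with root in, resp. not in the kernel, then it bounds them. -/
theorem tsum_treeProd_le_one (p : PMF ℕ) (z x a b : ℝ≥0∞) (hab : a + b = 1)
    (ha : z * x * ∑' k, p k * b ^ k ≤ a) (hb : z * ∑' k, p k * (1 - b ^ k) ≤ b) :
    ∑' F : PlaneForest, treeProd (fun G => p G.len * z * if G.rootIn then x else 1) F ≤ 1 := by
  set h : PlaneForest → ℝ≥0∞ := fun G => p G.len * z * if G.rootIn then x else 1 with hh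
  -- Truncating by size turns the fixed point equations into an iteration started at zero, which
  -- stays below any supersolution; no convergence has to be known beforehand.
  let t : ℕ → PlaneForest → ℝ≥0∞ := fun n F => if F.nodes < n then treeProd h F else 0
  have hforest : ∀ n (F : PlaneForest), F.nodes < n + 1 →
      forestProd (treeProd h) F = forestProd (t n) F := by
    intro n F
    induction F with
    | nil => exact fun _ => rfl
    | cons a b _ ihb =>
      intro hF
      rw [nodes] at hF
      rw [forestProd, forestProd, ihb (by omega)]
      simp only [t]
      rw [if_pos (by omega)]
  have hstep : ∀ n F, t (n + 1) F ≤ h F * forestProd (t n) F := by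
    intro n F
    by_cases hF : F.nodes < n + 1
    · rw [← hforest n F hF, ← treeProd_eq]
      simp [t, hF]
    · simp [t, hF]
  have hout : ∀ (g : PlaneForest → ℝ≥0∞) (F : PlaneForest),
      (if F.rootIn then forestProd g F else 0) =
        forestProd (fun G => if G.rootIn then 0 else g G) F := by
    intro g F
    induction F with
    | nil => simp [rootIn, forestProd]
    | cons a b _ ihb =>
      rw [forestProd, forestProd, ← ihb]
      cases ha : a.rootIn <;> cases hb : b.rootIn <;> simp [rootIn, ha, hb]
  have hsplit : ∀ g : PlaneForest → ℝ≥0∞, ∑' F, g F =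
      ∑' F, (if F.rootIn then g F else 0) + ∑' F, if F.rootIn then 0 else g F := by
    intro g
    rw [← ENNReal.tsum_add]
    exact tsum_congr fun F => by cases F.rootIn <;> simp
  have key : ∀ n, (∑' F, if F.rootIn then t n F else 0) ≤ a ∧
      (∑' F, if F.rootIn then 0 else t n F) ≤ b := by
    intro n
    induction n with
    | zero => simp [t]
    | succ n ih =>
      set A := ∑' F, if F.rootIn then t n F else 0
      set B := ∑' F, if F.rootIn then 0 else t n F
      constructor
      · refine le_trans ?_ ha
        calc ∑' F : PlaneForest, (if F.rootIn then t (n + 1) F else 0)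
            ≤ ∑' F : PlaneForest, z * x * (p F.len *
                forestProd (fun G => if G.rootIn then 0 else t n G) F) := by
              refine ENNReal.tsum_le_tsum fun F => ?_
              rw [← hout]
              cases hF : F.rootIn
              · simp
              · refine (hstep n F).trans_eq ?_
                simp only [hh, hF, if_true]
                ring
          _ = z * x * ∑' k, p k * B ^ k := by
              rw [ENNReal.tsum_mul_left, tsum_len_mul_forestProd]
          _ ≤ _ := by
              gcongr
              exact ih.2
      · refine le_trans ?_ hb
        have hR : ∀ k, (∑' F : PlaneForest, if F.len = k then
            (if F.rootIn then 0 else forestProd (t n) F) else 0) ≤ 1 - b ^ k := by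
          intro k
          set R := ∑' F : PlaneForest, if F.len = k then
            (if F.rootIn then 0 else forestProd (t n) F) else 0
          have h₁ : B ^ k + R = (A + B) ^ k := by
            rw [← hsplit (t n), ← tsum_forestProd_len, ← tsum_forestProd_len, ← ENNReal.tsum_add]
            refine tsum_congr fun F => ?_
            rw [← hout]
            by_cases hF : F.len = k <;> cases hF' : F.rootIn <;> simp [hF]
          have hbt : b ≤ 1 := hab ▸ le_add_self
          have hbt' : b ≠ ∞ := ne_top_of_le_ne_top ENNReal.one_ne_top hbt
          have hBt : B ≠ ∞ := ne_top_of_le_ne_top ENNReal.one_ne_top (ih.2.trans hbt)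
          have hmono := fun k => pow_add_pow_le_one_add_pow ih.1 ih.2 hab k
          refine ENNReal.le_sub_of_add_le_right (by finiteness) ?_
          have h₂ := hmono k
          rw [← h₁, add_assoc, add_comm (1 : ℝ≥0∞)] at h₂
          exact (ENNReal.add_le_add_iff_left (by finiteness)).1 h₂
        calc ∑' F : PlaneForest, (if F.rootIn then 0 else t (n + 1) F)
            ≤ ∑' F : PlaneForest, ∑' k, z * (p k * if F.len = k then
                (if F.rootIn then 0 else forestProd (t n) F) else 0) := by
              refine ENNReal.tsum_le_tsum fun F => ?_
              refine le_trans ?_ (ENNReal.le_tsum F.len)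
              cases hF : F.rootIn
              · refine le_trans (by simpa using hstep n F) (le_of_eq ?_)
                simp only [hh, hF, if_true, Bool.false_eq_true, if_false]
                ring
              · simp
          _ = z * ∑' k, p k * ∑' F : PlaneForest, if F.len = k then
                (if F.rootIn then 0 else forestProd (t n) F) else 0 := by
              rw [ENNReal.tsum_comm]
              simp_rw [ENNReal.tsum_mul_left]
          _ ≤ _ := by
              gcongr with k
              exact hR k
  rw [ENNReal.tsum_eq_iSup_sum]
  refine iSup_le fun s => ?_
  calc ∑ F ∈ s, treeProd h F = ∑ F ∈ s, t (s.sup nodes + 1) F := by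
        refine Finset.sum_congr rfl fun F hF => ?_
        simp only [t]
        rw [if_pos (Nat.lt_succ_of_le (Finset.le_sup hF))]
    _ ≤ ∑' F, t (s.sup nodes + 1) F := ENNReal.sum_le_tsum _
    _ ≤ a + b := by
        rw [hsplit]
        exact add_le_add (key _).1 (key _).2
    _ = 1 := hab

/-! ### Subexponential lower bound for the size probabilities -/

/-- Replace the first leaf, in depth-first order, of a tree by another tree. -/
def graft : PlaneForest → PlaneForest → PlaneForest
  | nil, G => G
  | cons a b, G => cons (graft a G) b

theorem nodes_graft (F G : PlaneForest) : (graft F G).nodes = F.nodes + G.nodes := by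
  induction F with
  | nil => simp [graft, nodes]
  | cons a b iha _ =>
    rw [graft, nodes, nodes, iha]
    ring

/-- Every node keeps its offspring number except the replaced leaf, whose factor `p 0` is lost. -/
theorem weight_graft (p : PMF ℕ) (F G : PlaneForest) :
    p 0 * (graft F G).weight p = F.weight p * G.weight p := by
  induction F with
  | nil => simp [graft, weight, subforests, len]
  | cons a b iha _ =>
    have : ∀ a : PlaneForest, (cons a b).weight p =
        a.weight p * (p (b.len + 1) * forestProd (treeProd fun G => p G.len) b) := by
      intro a
      rw [weight_eq_treeProd, treeProd_eq, forestProd, len, ← weight_eq_treeProd]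
      ring
    rw [graft, this, this, ← mul_assoc, iha]
    ring

/-- The size of the grafted tree locates the graft. Without it injectivity fails: `graft nil (cons a
b) = graft (cons nil b) a`. -/
theorem graft_injective {F G F' G' : PlaneForest} (hn : G.nodes = G'.nodes)
    (h : graft F G = graft F' G') : F = F' ∧ G = G' := by
  induction F generalizing F' with
  | nil =>
    cases F' with
    | nil => exact ⟨rfl, h⟩
    | cons a b =>
      have := congrArg nodes h
      rw [graft, graft, nodes, nodes_graft] at this
      omega
  | cons a b iha _ =>
    cases F' with
    | nil =>
      have := congrArg nodes h
      rw [graft, graft, nodes, nodes_graft] at this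
      omega
    | cons a' b' =>
      rw [graft, graft, cons.injEq] at h
      obtain ⟨rfl, rfl⟩ := iha h.1
      exact ⟨by rw [h.2], rfl⟩

/-- The probability that the branching tree with offspring distribution `p` has `n` nodes. -/
noncomputable def sizeMass (p : PMF ℕ) (n : ℕ) : ℝ≥0∞ :=
  ∑' F : {F : PlaneForest | F.nodes + 1 = n}, F.1.weight p

theorem sizeMass_mul_le (p : PMF ℕ) (n m : ℕ) :
    sizeMass p (n + 1) * sizeMass p (m + 1) ≤ p 0 * sizeMass p (n + m + 1) := by
  simp only [sizeMass]
  rw [← ENNReal.tsum_mul_right]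
  simp_rw [← ENNReal.tsum_mul_left]
  rw [← ENNReal.tsum_prod]
  let g : {F : PlaneForest | F.nodes + 1 = n + 1} × {F : PlaneForest | F.nodes + 1 = m + 1} →
      {F : PlaneForest | F.nodes + 1 = n + m + 1} := fun x => ⟨graft x.1 x.2, by
    have h₁ : x.1.1.nodes + 1 = n + 1 := x.1.2
    have h₂ : x.2.1.nodes + 1 = m + 1 := x.2.2
    show (graft _ _).nodes + 1 = _
    rw [nodes_graft]
    omega⟩
  have hg : Function.Injective g := by
    rintro ⟨⟨F, hF⟩, ⟨G, hG⟩⟩ ⟨⟨F', hF'⟩, ⟨G', hG'⟩⟩ h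
    have h' : graft F G = graft F' G' := congrArg Subtype.val h
    obtain ⟨rfl, rfl⟩ := graft_injective (Nat.succ_injective (hG.trans hG'.symm)) h'
    rfl
  refine le_trans (le_of_eq (tsum_congr fun x => ?_))
    (ENNReal.tsum_comp_le_tsum_of_injective hg fun F => p 0 * F.1.weight p)
  exact (weight_graft p _ _).symm

theorem tsum_sizeMass_mul_pow (p : PMF ℕ) (z : ℝ≥0∞) :
    ∑' n, sizeMass p n * z ^ n = ∑' F : PlaneForest, F.weight p * z ^ (F.nodes + 1) := by
  rw [← (Equiv.sigmaFiberEquiv fun F : PlaneForest => F.nodes + 1).tsum_eq, ENNReal.tsum_sigma']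
  refine tsum_congr fun n => ?_
  rw [sizeMass, ← ENNReal.tsum_mul_right]
  refine tsum_congr fun F => ?_
  obtain ⟨F, rfl⟩ := F
  rfl

theorem tsum_weight_mul_pow (p : PMF ℕ) (z : ℝ≥0∞) :
    ∑' F : PlaneForest, F.weight p * z ^ (F.nodes + 1) =
      z * ∑' k, p k * (∑' F : PlaneForest, F.weight p * z ^ (F.nodes + 1)) ^ k := by
  have h : ∀ F : PlaneForest, F.weight p * z ^ (F.nodes + 1) =
      treeProd (fun G => p G.len * z) F := by
    intro F
    simpa using (treeProd_weighted p z 1 F).symm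
  simp_rw [h]
  rw [← tsum_len_mul_forestProd (fun k => p k), ← ENNReal.tsum_mul_left]
  refine tsum_congr fun F => ?_
  rw [treeProd_eq]
  ring

/-- By convexity the generating function lies above its tangent at `1`, which is the diagonal as the
mean is one. Here `s > 1` is the case that matters, so the sum may be infinite. -/
theorem le_tsum_mul_pow (p : PMF ℕ) (hmean : ∑' k : ℕ, (k : ℝ≥0∞) * p k = 1) {s : ℝ≥0∞}
    (hs : s ≠ ∞) : s ≤ ∑' k, p k * s ^ k := by
  have bern : ∀ k : ℕ, k * s + 1 ≤ s ^ k + k := by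
    intro k
    lift s to NNReal using hs
    have := one_add_mul_le_pow (a := (s : ℝ) - 1) (by linarith [s.2]) k
    have h : (k : ℝ) * s + 1 ≤ (s : ℝ) ^ k + k := by
      rw [add_sub_cancel] at this
      linarith
    exact_mod_cast h
  have h : s + 1 ≤ (∑' k, p k * s ^ k) + 1 := by
    calc s + 1 = ∑' k, p k * (k * s + 1) := by
          simp_rw [mul_add, mul_one, ← mul_assoc]
          rw [ENNReal.tsum_add, p.tsum_coe, ENNReal.tsum_mul_right]
          simp_rw [mul_comm (p _)]
          rw [hmean, one_mul]
      _ ≤ ∑' k, p k * (s ^ k + k) := by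
          refine ENNReal.tsum_le_tsum fun k => ?_
          exact mul_le_mul' le_rfl (bern k)
      _ = _ := by
          simp_rw [mul_add]
          rw [ENNReal.tsum_add]
          simp_rw [mul_comm (p _) (Nat.cast _)]
          rw [hmean]
  exact (ENNReal.add_le_add_iff_right ENNReal.one_ne_top).1 h

/-- The size of a critical branching tree has no exponential moments. -/
theorem tsum_sizeMass_mul_pow_eq_top (p : PMF ℕ) (hmean : ∑' k : ℕ, (k : ℝ≥0∞) * p k = 1)
    (h0 : p 0 ≠ 0) {z : ℝ≥0∞} (hz : 1 < z) : ∑' n, sizeMass p n * z ^ n = ∞ := by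
  rw [tsum_sizeMass_mul_pow]
  by_contra hfin
  have h₁ := tsum_weight_mul_pow p z
  set Y := ∑' F : PlaneForest, F.weight p * z ^ (F.nodes + 1)
  have hY : Y ≠ 0 := by
    intro h
    have := ENNReal.tsum_eq_zero.1 h nil
    simp [weight, subforests, len, nodes, h0] at this
    simp [this] at hz
  have h₂ : z * Y ≤ 1 * Y := by
    rw [one_mul]
    conv_rhs => rw [h₁]
    gcongr
    exact le_tsum_mul_pow p hmean hfin
  exact absurd ((ENNReal.mul_le_mul_iff_left hY hfin).1 h₂) (not_le.2 hz)

/-- In each residue class modulo `m`, start from the least index where `u` is nonzero and multiply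
repeatedly by `u m ≥ r ^ m`. Classes on which `u` vanishes impose nothing, which handles periodic
offspring laws. -/
theorem exists_pow_le_of_supermultiplicative {u : ℕ → ℝ} (h0 : ∀ n, 0 ≤ u n)
    (hu : ∀ n m, u n * u m ≤ u (n + m)) {m : ℕ} (hm : 0 < m) {r : ℝ} (hr0 : 0 < r) (hr1 : r ≤ 1)
    (hrm : r ^ m ≤ u m) : ∃ c > 0, ∀ n, u n ≠ 0 → c * r ^ n ≤ u n := by
  have hclass : ∀ j ∈ Finset.range m, ∀ᶠ c : ℝ in 𝓝[>] 0, ∀ n, n % m = j → u n ≠ 0 →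
      c * r ^ n ≤ u n := by
    intro j _
    by_cases hj : ∃ n, n % m = j ∧ u n ≠ 0
    · classical
      obtain ⟨hn₁, hn₂⟩ := Nat.find_spec hj
      set N := Nat.find hj
      have hN : 0 < u N := lt_of_le_of_ne (h0 N) hn₂.symm
      filter_upwards [Ioo_mem_nhdsGT hN] with c hc n hnj hn
      have hle : N ≤ n := Nat.find_min' hj ⟨hnj, hn⟩
      obtain ⟨k, hk⟩ : m ∣ n - N := (Nat.modEq_iff_dvd' hle).1 (hn₁.trans hnj.symm)
      obtain rfl : n = N + m * k := by omega
      have hpow : ∀ k, u N * (r ^ m) ^ k ≤ u (N + m * k) := by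
        intro k
        induction k with
        | zero => simp
        | succ k ih =>
          calc u N * (r ^ m) ^ (k + 1) = u N * (r ^ m) ^ k * r ^ m := by ring
            _ ≤ u (N + m * k) * u m := mul_le_mul ih hrm (by positivity) (h0 _)
            _ ≤ u (N + m * k + m) := hu _ _
            _ = u (N + m * (k + 1)) := by rw [mul_add, mul_one, add_assoc]
      calc c * r ^ (N + m * k) = c * (r ^ N * (r ^ m) ^ k) := by rw [pow_add, pow_mul]
        _ ≤ u N * (1 * (r ^ m) ^ k) := by
            have := pow_le_one₀ hr0.le hr1 (n := N)
            gcongr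
            exact hc.2.le
        _ ≤ _ := by simpa using hpow k
    · push Not at hj
      exact Eventually.of_forall fun c n hn hn' => absurd (hj n hn) hn'
  obtain ⟨c, hc, hc0⟩ := (((Finset.eventually_all _).2 hclass).and self_mem_nhdsWithin).exists
  exact ⟨c, hc0, fun n => hc _ (Finset.mem_range.2 (Nat.mod_lt n hm)) n rfl⟩

/-- The size probabilities of a critical branching tree do not decay exponentially along the
sizes that it has with positive probability. -/
theorem exists_pow_le_sizeMass (p : PMF ℕ) (hmean : ∑' k : ℕ, (k : ℝ≥0∞) * p k = 1)
    (h0 : p 0 ≠ 0) (hle : ∀ n, sizeMass p n ≤ 1) {r : ℝ} (hr0 : 0 < r) (hr1 : r < 1) :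
    ∃ c > 0, ∀ n, sizeMass p n ≠ 0 → c * r ^ n ≤ (sizeMass p n).toReal := by
  have hfin : ∀ n, sizeMass p n ≠ ∞ := fun n => ne_top_of_le_ne_top ENNReal.one_ne_top (hle n)
  have hp0 : 0 < (p 0).toReal := ENNReal.toReal_pos h0 (p.apply_ne_top 0)
  have hp1 : (p 0).toReal ≤ 1 := ENNReal.toReal_le_of_le_ofReal zero_le_one (by
    simpa using p.coe_le_one 0)
  have hzero : sizeMass p 0 = 0 := by simp [sizeMass]
  -- Otherwise the size probabilities would decay like `r ^ m`, and the generating function would be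
  -- finite at any `z` between `1` and `r⁻¹`.
  obtain ⟨m, hm, hrm⟩ : ∃ m > 0, ENNReal.ofReal (r ^ m) ≤ sizeMass p (m + 1) := by
    by_contra! hcon
    obtain ⟨z, hz1, hzr⟩ := exists_between
      (ENNReal.one_lt_inv.2 (ENNReal.ofReal_lt_one.2 hr1))
    have hbound : ∀ m, sizeMass p (m + 1) ≤ ENNReal.ofReal r ^ m := by
      intro m
      rcases Nat.eq_zero_or_pos m with rfl | hm
      · simpa using hle 1
      · rw [← ENNReal.ofReal_pow hr0.le]
        exact (hcon m hm).le
    have hzr' : ENNReal.ofReal r * z < 1 := by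
      rw [mul_comm]
      refine ENNReal.mul_lt_of_lt_div ?_
      simpa using hzr
    refine absurd (tsum_sizeMass_mul_pow_eq_top p hmean h0 hz1) (ne_of_lt ?_)
    rw [tsum_eq_zero_add' ENNReal.summable, hzero, zero_mul, zero_add]
    calc ∑' n, sizeMass p (n + 1) * z ^ (n + 1)
        ≤ ∑' n, z * (ENNReal.ofReal r * z) ^ n := by
          refine ENNReal.tsum_le_tsum fun n => ?_
          rw [mul_pow, pow_succ, ← mul_assoc, mul_comm z]
          gcongr
          exact hbound n
      _ < ∞ := by
          rw [ENNReal.tsum_mul_left, ENNReal.tsum_geometric]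
          refine ENNReal.mul_lt_top (hzr.trans_le le_top) ?_
          exact ENNReal.inv_lt_top.2 (tsub_pos_of_lt hzr')
  have hrm' : r ^ m ≤ (sizeMass p (m + 1)).toReal := by
    rw [← ENNReal.toReal_ofReal (pow_nonneg hr0.le m)]
    exact ENNReal.toReal_mono (hfin _) hrm
  obtain ⟨c, hc, h⟩ := exists_pow_le_of_supermultiplicative
    -- Counting non-root nodes and dividing by `p 0` absorbs the leaf lost in a graft, so `u` is
    -- exactly supermultiplicative.
    (u := fun n => (sizeMass p (n + 1)).toReal / (p 0).toReal) (fun n => by positivity)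
    (fun n m => by
      rw [div_mul_div_comm, div_le_div_iff₀ (by positivity) hp0]
      have := ENNReal.toReal_mono (ENNReal.mul_ne_top (p.apply_ne_top 0) (hfin _))
        (sizeMass_mul_le p n m)
      rw [ENNReal.toReal_mul, ENNReal.toReal_mul] at this
      nlinarith) hm hr0 hr1.le (hrm'.trans (le_div_self ENNReal.toReal_nonneg hp0 hp1))
  refine ⟨c * (p 0).toReal, by positivity, fun n hn => ?_⟩
  cases n with
  | zero => exact absurd hzero hn
  | succ n =>
    have := h n (div_ne_zero (ENNReal.toReal_ne_zero.2 ⟨hn, hfin _⟩) hp0.ne')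
    rw [le_div_iff₀ hp0] at this
    refine le_trans ?_ this
    have h₁ : r ^ (n + 1) ≤ r ^ n := pow_le_pow_of_le_one hr0.le hr1.le n.le_succ
    calc c * (p 0).toReal * r ^ (n + 1) ≤ c * (p 0).toReal * r ^ n := by gcongr
      _ = _ := by ring

end PlaneForest

/-! ### The offspring generating function and its fixed point equation -/

section GenFun

variable (p : PMF ℕ)

theorem hasSum_toReal_pmf : HasSum (fun k => (p k).toReal) 1 := by
  have h := ENNReal.hasSum_toReal (f := fun k => p k) (by rw [p.tsum_coe]; exact ENNReal.one_ne_top)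
  rwa [← ENNReal.tsum_toReal_eq p.apply_ne_top, p.tsum_coe, ENNReal.toReal_one] at h

theorem hasSum_mean {p : PMF ℕ} (hmean : ∑' k : ℕ, (k : ℝ≥0∞) * p k = 1) :
    HasSum (fun k : ℕ => (p k).toReal * k) 1 := by
  have h := ENNReal.hasSum_toReal (f := fun k : ℕ => (k : ℝ≥0∞) * p k)
    (by rw [hmean]; exact ENNReal.one_ne_top)
  rw [← ENNReal.tsum_toReal_eq fun k => ENNReal.mul_ne_top (ENNReal.natCast_ne_top k)
    (p.apply_ne_top k), hmean, ENNReal.toReal_one] at h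
  simpa [mul_comm] using h

theorem mul_pow_le_of_mem_Icc {s : ℝ} (hs : s ∈ Set.Icc (0 : ℝ) 1) (k : ℕ) :
    (p k).toReal * s ^ k ≤ (p k).toReal :=
  mul_le_of_le_one_right ENNReal.toReal_nonneg (pow_le_one₀ hs.1 hs.2)

theorem summable_offspringGenFun {s : ℝ} (hs : s ∈ Set.Icc (0 : ℝ) 1) :
    Summable fun k => (p k).toReal * s ^ k :=
  Summable.of_nonneg_of_le (fun k => mul_nonneg ENNReal.toReal_nonneg (pow_nonneg hs.1 k))
    (mul_pow_le_of_mem_Icc p hs) (hasSum_toReal_pmf p).summable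

theorem offspringGenFun_mono {s t : ℝ} (hs : 0 ≤ s) (hst : s ≤ t) (ht : t ≤ 1) :
    offspringGenFun p s ≤ offspringGenFun p t :=
  (summable_offspringGenFun p ⟨hs, hst.trans ht⟩).tsum_le_tsum
    (fun k => by gcongr) (summable_offspringGenFun p ⟨hs.trans hst, ht⟩)

theorem continuousOn_offspringGenFun : ContinuousOn (offspringGenFun p) (Set.Icc 0 1) := by
  refine continuousOn_tsum (fun k => by fun_prop) (hasSum_toReal_pmf p).summable fun k s hs => ?_
  rw [Real.norm_of_nonneg (mul_nonneg ENNReal.toReal_nonneg (pow_nonneg hs.1 k))]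
  exact mul_pow_le_of_mem_Icc p hs k

theorem offspringGenFun_zero : offspringGenFun p 0 = (p 0).toReal := by
  rw [offspringGenFun, tsum_eq_single 0 fun k hk => by simp [hk]]
  simp

theorem exists_hasDerivAt_offspringGenFun {p : PMF ℕ} (hmean : ∑' k : ℕ, (k : ℝ≥0∞) * p k = 1)
    {s : ℝ} (hs : s ∈ Set.Ioo (0 : ℝ) 1) : ∃ m, 0 ≤ m ∧ HasDerivAt (offspringGenFun p) m s := by
  refine ⟨∑' k : ℕ, (p k).toReal * (k * s ^ (k - 1)),
    tsum_nonneg fun k => mul_nonneg ENNReal.toReal_nonneg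
      (mul_nonneg k.cast_nonneg (pow_nonneg hs.1.le _)), ?_⟩
  refine hasDerivAt_tsum_of_isPreconnected (hasSum_mean hmean).summable isOpen_Ioo
    isPreconnected_Ioo (fun k y _ => (hasDerivAt_pow k y).const_mul _) (fun k y hy => ?_) hs
    (summable_offspringGenFun p (Set.Ioo_subset_Icc_self hs)) hs
  have h₁ : (0 : ℝ) ≤ y ^ (k - 1) := pow_nonneg hy.1.le _
  rw [Real.norm_of_nonneg (by positivity)]
  gcongr
  exact mul_le_of_le_one_right k.cast_nonneg (pow_le_one₀ hy.1.le hy.2.le)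

/-- Averaging Bernoulli's inequality `1 - k / 2 ≤ (1 / 2) ^ k` gives the weak bound; a nondegenerate
law of mean one charges some `k ≥ 2`, where the inequality is strict. -/
theorem half_lt_offspringGenFun_half {p : PMF ℕ} (hmean : ∑' k : ℕ, (k : ℝ≥0∞) * p k = 1)
    (hnondeg : p 1 ≠ 1) : 1 / 2 < offspringGenFun p (1 / 2) := by
  obtain ⟨k, hk2, hk⟩ : ∃ k, 2 ≤ k ∧ p k ≠ 0 := by
    by_contra! h
    apply hnondeg
    rw [tsum_eq_single 1] at hmean
    · simpa using hmean
    · intro k hk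
      rcases Nat.lt_or_ge k 2 with h' | h'
      · obtain rfl : k = 0 := by omega
        simp
      · simp [h k h']
  have h₁ : HasSum (fun k : ℕ => (p k).toReal - (p k).toReal * k * (1 / 2)) (1 - 1 * (1 / 2)) :=
    (hasSum_toReal_pmf p).sub ((hasSum_mean hmean).mul_right _)
  have bern : ∀ k : ℕ, (1 : ℝ) - k * (1 / 2) ≤ (1 / 2) ^ k := by
    intro k
    have := one_add_mul_le_pow (a := (-1 / 2 : ℝ)) (by norm_num) k
    norm_num at this ⊢
    linarith
  have h₂ : (1 : ℝ) - k * (1 / 2) < (1 / 2) ^ k := by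
    have : (2 : ℝ) ≤ k := by exact_mod_cast hk2
    have : (0 : ℝ) < (1 / 2) ^ k := by positivity
    linarith
  have hpk : 0 < (p k).toReal := ENNReal.toReal_pos hk (p.apply_ne_top k)
  have h₃ := hasSum_lt (i := k)
    (fun k => by
      have := mul_le_mul_of_nonneg_left (bern k) (ENNReal.toReal_nonneg (a := p k))
      linarith)
    (by
      have := mul_lt_mul_of_pos_left h₂ hpk
      linarith)
    h₁ (summable_offspringGenFun p (s := 1 / 2) (by norm_num)).hasSum
  rw [offspringGenFun]
  linarith

theorem pmf_zero_ne_one {p : PMF ℕ} (hmean : ∑' k : ℕ, (k : ℝ≥0∞) * p k = 1) : p 0 ≠ 1 := by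
  intro h
  rw [PMF.apply_eq_one_iff] at h
  have : ∀ k : ℕ, (k : ℝ≥0∞) * p k = 0 := by
    intro k
    rcases eq_or_ne k 0 with rfl | hk
    · simp
    · have : k ∉ p.support := by rw [h]; simpa using hk
      rw [(p.apply_eq_zero_iff k).2 this, mul_zero]
  simp [this] at hmean

/-- If `p 0 = 0`, then `ξ - 1` is nonnegative with mean zero, hence vanishes almost surely. -/
theorem pmf_zero_ne_zero {p : PMF ℕ} (hmean : ∑' k : ℕ, (k : ℝ≥0∞) * p k = 1)
    (hnondeg : p 1 ≠ 1) : p 0 ≠ 0 := by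
  intro h0
  have h := (hasSum_mean hmean).sub (hasSum_toReal_pmf p)
  rw [sub_self, hasSum_zero_iff_of_nonneg] at h
  · apply hnondeg
    rw [tsum_eq_single 1] at hmean
    · simpa using hmean
    · intro k hk
      rcases Nat.eq_zero_or_pos k with rfl | hk'
      · simp
      · have h₁ := congrFun h k
        have h₂ : (k : ℝ) - 1 ≠ 0 := sub_ne_zero.2 (by exact_mod_cast hk)
        have h₃ : (p k).toReal * ((k : ℝ) - 1) = 0 := by
          rw [mul_sub, mul_one]
          simpa using h₁
        have h₄ : (p k).toReal = 0 := (mul_eq_zero.1 h₃).resolve_right h₂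
        rw [((ENNReal.toReal_eq_zero_iff _).1 h₄).resolve_right (p.apply_ne_top k), mul_zero]
  · intro k
    rcases Nat.eq_zero_or_pos k with rfl | hk'
    · simp [h0]
    · have : (1 : ℝ) ≤ k := by exact_mod_cast hk'
      simpa using le_mul_of_one_le_right (ENNReal.toReal_nonneg (a := p k)) this

theorem exists_eq_offspringGenFun {p : PMF ℕ} (hmean : ∑' k : ℕ, (k : ℝ≥0∞) * p k = 1)
    (hnondeg : p 1 ≠ 1) :
    ∃ q ∈ Set.Ioo (1 / 2 : ℝ) 1, q = offspringGenFun p (1 - q) := by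
  have hcont : ContinuousOn (fun q => q - offspringGenFun p (1 - q)) (Set.Icc (1 / 2 : ℝ) 1) := by
    refine continuousOn_id.sub ((continuousOn_offspringGenFun p).comp (by fun_prop) ?_)
    intro q hq
    simp only [Set.mem_Icc] at hq ⊢
    constructor <;> linarith
  have h₁ : 1 / 2 - offspringGenFun p (1 - 1 / 2) < 0 := by
    have := half_lt_offspringGenFun_half hmean hnondeg
    norm_num at this ⊢
    linarith
  have h₂ : 0 < 1 - offspringGenFun p (1 - 1) := by
    rw [sub_self, offspringGenFun_zero, sub_pos]
    have := (ENNReal.toReal_lt_toReal (p.apply_ne_top 0) ENNReal.one_ne_top).2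
      (lt_of_le_of_ne (p.coe_le_one 0) (pmf_zero_ne_one hmean))
    simpa using this
  obtain ⟨q, hq, hq'⟩ := intermediate_value_Ioo (by norm_num) hcont ⟨h₁, h₂⟩
  exact ⟨q, hq, sub_eq_zero.1 hq'⟩

/-- The left side of the equation increases in `q` while `f (1 - q)` is nonincreasing. -/
theorem eq_of_eq_offspringGenFun {q q' : ℝ} (hq : q ∈ Set.Icc (0 : ℝ) 1)
    (hq' : q' ∈ Set.Icc (0 : ℝ) 1) (h : q = offspringGenFun p (1 - q))
    (h' : q' = offspringGenFun p (1 - q')) : q' = q := by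
  wlog hle : q ≤ q' generalizing q q'
  · exact (this hq' hq h' h (le_of_not_ge hle)).symm
  refine le_antisymm ?_ hle
  rw [h, h']
  exact offspringGenFun_mono p (by linarith [hq'.2]) (by linarith) (by linarith [hq.1])

theorem tsum_mul_ofReal_pow {s : ℝ} (hs : s ∈ Set.Icc (0 : ℝ) 1) :
    ∑' k, p k * ENNReal.ofReal s ^ k = ENNReal.ofReal (offspringGenFun p s) := by
  rw [offspringGenFun, ENNReal.ofReal_tsum_of_nonneg
    (fun k => mul_nonneg ENNReal.toReal_nonneg (pow_nonneg hs.1 k)) (summable_offspringGenFun p hs)]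
  refine tsum_congr fun k => ?_
  rw [ENNReal.ofReal_mul ENNReal.toReal_nonneg, ENNReal.ofReal_toReal (p.apply_ne_top k),
    ENNReal.ofReal_pow hs.1]

theorem tsum_mul_one_sub_ofReal_pow {s : ℝ} (hs : s ∈ Set.Icc (0 : ℝ) 1) :
    ∑' k, p k * (1 - ENNReal.ofReal s ^ k) = ENNReal.ofReal (1 - offspringGenFun p s) := by
  have h := (hasSum_toReal_pmf p).sub (summable_offspringGenFun p hs).hasSum
  rw [offspringGenFun, ← h.tsum_eq, ENNReal.ofReal_tsum_of_nonneg
    (fun k => sub_nonneg.2 (mul_pow_le_of_mem_Icc p hs k)) h.summable]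
  refine tsum_congr fun k => ?_
  rw [← ENNReal.ofReal_pow hs.1, ← ENNReal.ofReal_one, ← ENNReal.ofReal_sub _ (pow_nonneg hs.1 k),
    ← mul_one_sub, ENNReal.ofReal_mul ENNReal.toReal_nonneg,
    ENNReal.ofReal_toReal (p.apply_ne_top k)]

end GenFun

/-! ### Exponential tilting and the tail bound -/

/-- Tilting the fixed point equation `q = f (1 - q)` by `exp (t * s)` per node counted by `q`
leaves room for a supersolution, when each node is discounted by `exp (- t * (s * q + ε))`. -/
theorem exists_tilted_supersolution {f : ℝ → ℝ} {q m s ε : ℝ} (hq0 : 0 < q) (hq1 : q < 1)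
    (hq : q = f (1 - q)) (hm : 0 ≤ m) (hf : HasDerivAt f m (1 - q)) (hε : 0 < ε) :
    ∃ t > 0, ∃ a ∈ Set.Icc (0 : ℝ) 1,
      Real.exp (t * (-(s * q) - ε)) * Real.exp (t * s) * f (1 - a) ≤ a ∧
      Real.exp (t * (-(s * q) - ε)) * (1 - f (1 - a)) ≤ 1 - a := by
  -- This `α` cancels the first-order effect of `s` in both inequalities at once, leaving slacks
  -- with derivatives `ε * q` and `ε * (1 - q)` at `t = 0`.
  set α := s * q * (1 - q) / (1 + m) with hα
  have hαm : α * (1 + m) = s * q * (1 - q) := div_mul_cancel₀ _ (by positivity)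
  have ha : HasDerivAt (fun t : ℝ => q + t * α) α 0 := by
    simpa using ((hasDerivAt_id (0 : ℝ)).mul_const α).const_add q
  have hfa : HasDerivAt (fun t : ℝ => f (1 - (q + t * α))) (m * -α) 0 := by
    have h₁ : HasDerivAt (fun t : ℝ => 1 - (q + t * α)) (-α) 0 := ha.const_sub 1
    refine HasDerivAt.comp (h₂ := f) 0 ?_ h₁
    simpa using hf
  have hexp : ∀ r : ℝ, HasDerivAt (fun t : ℝ => Real.exp (t * r)) r 0 := by
    intro r
    simpa using ((hasDerivAt_id (0 : ℝ)).mul_const r).exp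
  have pos : ∀ {φ : ℝ → ℝ} {d : ℝ}, HasDerivAt φ d 0 → φ 0 = 0 → 0 < d →
      ∀ᶠ t in 𝓝[>] (0 : ℝ), 0 < φ t := by
    intro φ d hφ h0 hd
    have h := (hasDerivAt_iff_tendsto_slope.1 hφ).mono_left
      (nhdsWithin_mono 0 fun t (ht : 0 < t) => ht.ne')
    filter_upwards [h.eventually (lt_mem_nhds hd), self_mem_nhdsWithin] with t ht ht0
    rw [slope_def_field, h0, sub_zero, sub_zero] at ht
    exact (div_pos_iff_of_pos_right ht0).1 ht
  have e₁ := pos (ha.sub (((hexp (-(s * q) - ε)).mul (hexp s)).mul hfa))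
    (by simp [← hq]) (by
      simp only [Pi.mul_apply, zero_mul, Real.exp_zero, add_zero, ← hq]
      linarith [mul_pos hε hq0])
  have e₂ := pos ((ha.const_sub 1).sub ((hexp (-(s * q) - ε)).mul (hfa.const_sub 1)))
    (by simp [← hq]) (by
      simp only [zero_mul, Real.exp_zero, add_zero, ← hq]
      linarith [mul_pos hε (sub_pos.2 hq1)])
  have e₃ : ∀ᶠ t in 𝓝[>] (0 : ℝ), q + t * α ∈ Set.Icc (0 : ℝ) 1 := by
    refine (ha.continuousAt.mono_left nhdsWithin_le_nhds).eventually ?_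
    beta_reduce
    rw [zero_mul, add_zero]
    exact Icc_mem_nhds hq0 hq1
  obtain ⟨t, ⟨h₁, h₂⟩, h₃, ht⟩ := ((e₁.and e₂).and (e₃.and self_mem_nhdsWithin)).exists
  exact ⟨t, ht, _, h₃, (sub_pos.1 h₁).le, (sub_pos.1 h₂).le⟩

namespace PlaneForest

/-- One-sided exponential tail bound for the independence number, on the side of the sign
of `s`. -/
theorem exists_tsum_weight_le_pow {p : PMF ℕ} (hmean : ∑' k : ℕ, (k : ℝ≥0∞) * p k = 1) {q : ℝ}
    (hq0 : 0 < q) (hq1 : q < 1) (hq : q = offspringGenFun p (1 - q)) (s : ℝ) {ε : ℝ} (hε : 0 < ε) :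
    ∃ r ∈ Set.Ioo (0 : ℝ) 1, ∀ n : ℕ,
      ∑' F : {F : PlaneForest | F.nodes + 1 = n ∧ ε * n < s * (F.indep - q * n)}, F.1.weight p ≤
        ENNReal.ofReal (r ^ n) := by
  obtain ⟨m, hm, hf⟩ := exists_hasDerivAt_offspringGenFun hmean (s := 1 - q)
    ⟨by linarith, by linarith⟩
  -- Half of `ε` pays for the supersolution; the other half is the exponential decay rate, up to the
  -- factor `t`.
  obtain ⟨t, ht, a, ha, h₁, h₂⟩ := exists_tilted_supersolution (s := s) hq0 hq1 hq hm hf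
    (half_pos hε)
  refine ⟨Real.exp (-(t * (ε / 2))), ⟨Real.exp_pos _, Real.exp_lt_one_iff.2 (by
    have := mul_pos ht (half_pos hε)
    linarith)⟩, fun n => ?_⟩
  set z := Real.exp (t * (-(s * q) - ε / 2)) with hz
  set x := Real.exp (t * s) with hx
  have ha' : 1 - a ∈ Set.Icc (0 : ℝ) 1 := ⟨by linarith [ha.2], by linarith [ha.1]⟩
  have htot := tsum_treeProd_le_one p (ENNReal.ofReal z) (ENNReal.ofReal x) (ENNReal.ofReal a)
    (ENNReal.ofReal (1 - a)) (by rw [← ENNReal.ofReal_add ha.1 ha'.1]; simp)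
    (by
      rw [tsum_mul_ofReal_pow p ha', ← ENNReal.ofReal_mul (Real.exp_pos _).le,
        ← ENNReal.ofReal_mul (by positivity)]
      exact ENNReal.ofReal_le_ofReal h₁)
    (by
      rw [tsum_mul_one_sub_ofReal_pow p ha', ← ENNReal.ofReal_mul (Real.exp_pos _).le]
      exact ENNReal.ofReal_le_ofReal h₂)
  calc ∑' F : {F : PlaneForest | F.nodes + 1 = n ∧ ε * n < s * (F.indep - q * n)}, F.1.weight p
      ≤ ∑' F : {F : PlaneForest | F.nodes + 1 = n ∧ ε * n < s * (F.indep - q * n)},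
        ENNReal.ofReal (Real.exp (-(t * (ε / 2))) ^ n) *
          treeProd (fun G => p G.len * ENNReal.ofReal z *
            if G.rootIn then ENNReal.ofReal x else 1) F.1 := by
        refine ENNReal.tsum_le_tsum fun F => ?_
        obtain ⟨F, rfl, hF⟩ := F
        -- Chernoff bound: with `n = F.nodes + 1`, the total exponent is `t * (s * (F.indep - q * n)
        -- - ε * n)`, positive on the deviation event.
        have h : (1 : ℝ) ≤ Real.exp (-(t * (ε / 2))) ^ (F.nodes + 1) *
            (z ^ (F.nodes + 1) * x ^ F.indep) := by
          simp only [hz, hx, ← Real.exp_nat_mul, ← Real.exp_add]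
          rw [Real.one_le_exp_iff]
          have := mul_lt_mul_of_pos_left hF ht
          linarith
        rw [treeProd_weighted, mul_assoc, mul_left_comm, ← ENNReal.ofReal_pow (Real.exp_pos _).le,
          ← ENNReal.ofReal_pow (Real.exp_pos _).le, ← ENNReal.ofReal_mul (by positivity),
          ← ENNReal.ofReal_mul (by positivity)]
        exact le_mul_of_one_le_right' (ENNReal.one_le_ofReal.2 h)
    _ ≤ ENNReal.ofReal (Real.exp (-(t * (ε / 2))) ^ n) * 1 := by
        rw [ENNReal.tsum_mul_left]
        gcongr
        exact (ENNReal.tsum_comp_le_tsum_of_injective Subtype.val_injective _).trans htot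
    _ = _ := mul_one _

end PlaneForest

/-! ### Convergence in probability -/

theorem theorem2 {Ω : Type*} [MeasurableSpace Ω] (P : Measure Ω) [IsProbabilityMeasure P]
    -- the offspring distribution: mean one, and not the point mass at one
    (p : PMF ℕ) (hmean : ∑' k : ℕ, (k : ℝ≥0∞) * p k = 1) (hnondeg : p 1 ≠ 1)
    -- the offspring numbers of the potential nodes: independent, all with distribution `p`
    (ξ : List ℕ → Ω → ℕ) (hmeas : ∀ u, Measurable (ξ u))
    (hlaw : ∀ u, P.map (ξ u) = p.toMeasure) (hindep : iIndepFun ξ P) :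
    ∃ q : ℝ, q ∈ Set.Ioo (1 / 2 : ℝ) 1 ∧ q = offspringGenFun p (1 - q) ∧
      (∀ q' ∈ Set.Ioo (1 / 2 : ℝ) 1, q' = offspringGenFun p (1 - q') → q' = q) ∧
      -- convergence in probability of the conditioned trees, as `n → ∞` through the sizes
      -- that the tree has with positive probability
      ∀ ε : ℝ, 0 < ε →
        Tendsto
          (fun n : ℕ => ProbabilityTheory.cond P (treeSizeEvent ξ n)
            {ω | ε < |(treeIndepNum ξ ω : ℝ) / (n : ℝ) - q|})
          (atTop ⊓ 𝓟 {n : ℕ | P (treeSizeEvent ξ n) ≠ 0}) (𝓝 0) := by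
  obtain ⟨q, hqI, hq⟩ := exists_eq_offspringGenFun hmean hnondeg
  have hq0 : 0 < q := lt_trans (by norm_num) hqI.1
  refine ⟨q, hqI, hq, fun q' hq'I hq' => eq_of_eq_offspringGenFun p ⟨hq0.le, hqI.2.le⟩
    ⟨(lt_trans (by norm_num) hq'I.1).le, hq'I.2.le⟩ hq hq', fun ε hε => ?_⟩
  have hsize : ∀ n, P (treeSizeEvent ξ n) = PlaneForest.sizeMass p n :=
    PlaneForest.measure_treeSizeEvent hmeas hlaw hindep
  have htail : ∀ s : ℝ, ∃ r ∈ Set.Ioo (0 : ℝ) 1, ∀ n : ℕ, P (treeSizeEvent ξ n ∩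
      {ω | ε * n < s * (treeIndepNum ξ ω - q * n)}) ≤ ENNReal.ofReal (r ^ n) := by
    intro s
    obtain ⟨r, hr, h⟩ := PlaneForest.exists_tsum_weight_le_pow hmean hq0 hqI.2 hq s hε
    exact ⟨r, hr, fun n => (PlaneForest.measure_treeSizeEvent_inter_le hmeas hlaw hindep n
      fun i => ε * n < s * (i - q * n)).trans (h n)⟩
  obtain ⟨r₁, hr₁, h₁⟩ := htail 1
  obtain ⟨r₂, hr₂, h₂⟩ := htail (-1)
  set r := max r₁ r₂
  have hr0 : 0 < r := lt_max_of_lt_left hr₁.1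
  -- The size probabilities are at least of order `ρ ^ n` where nonzero, so `r < ρ` makes the
  -- conditional probability `O((r / ρ) ^ n)`.
  obtain ⟨ρ, hrρ, hρ1⟩ := exists_between (max_lt hr₁.2 hr₂.2)
  have hρ0 : 0 < ρ := hr0.trans hrρ
  obtain ⟨c, hc, hlow⟩ := PlaneForest.exists_pow_le_sizeMass p hmean
    (pmf_zero_ne_zero hmean hnondeg) (fun n => by rw [← hsize]; exact prob_le_one) hρ0 hρ1
  have hlim : Tendsto (fun n : ℕ => ENNReal.ofReal (2 / c * (r / ρ) ^ n)) atTop (𝓝 0) := by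
    rw [← ENNReal.ofReal_zero]
    refine ENNReal.tendsto_ofReal ?_
    simpa using (tendsto_pow_atTop_nhds_zero_of_lt_one (by positivity)
      ((div_lt_one hρ0).2 hrρ)).const_mul (2 / c)
  refine tendsto_of_tendsto_of_tendsto_of_le_of_le' tendsto_const_nhds
    (hlim.mono_left inf_le_left) (Eventually.of_forall fun _ => zero_le) ?_
  rw [eventually_inf_principal]
  filter_upwards [eventually_gt_atTop 0] with n hn0 hn
  replace hn : PlaneForest.sizeMass p n ≠ 0 := hsize n ▸ hn
  have hn' : (0 : ℝ) < n := by exact_mod_cast hn0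
  rw [cond_apply (PlaneForest.measurableSet_treeSizeEvent hmeas n)]
  have hdev : P (treeSizeEvent ξ n ∩ {ω | ε < |(treeIndepNum ξ ω : ℝ) / (n : ℝ) - q|}) ≤
      ENNReal.ofReal (2 * r ^ n) := by
    have hsub : treeSizeEvent ξ n ∩ {ω | ε < |(treeIndepNum ξ ω : ℝ) / (n : ℝ) - q|} ⊆
        (treeSizeEvent ξ n ∩ {ω | ε * n < 1 * (treeIndepNum ξ ω - q * n)}) ∪
          (treeSizeEvent ξ n ∩ {ω | ε * n < (-1) * (treeIndepNum ξ ω - q * n)}) := by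
      rintro ω ⟨hω, hε'⟩
      rw [Set.mem_ofPred_eq] at hε'
      have h : (treeIndepNum ξ ω : ℝ) - q * n = ((treeIndepNum ξ ω : ℝ) / n - q) * n := by
        field_simp
      rcases lt_abs.1 hε' with h' | h'
      · refine Or.inl ⟨hω, ?_⟩
        rw [Set.mem_ofPred_eq, h, one_mul]
        gcongr
      · refine Or.inr ⟨hω, ?_⟩
        rw [Set.mem_ofPred_eq, h, ← mul_assoc, neg_one_mul]
        gcongr
    refine (measure_mono hsub).trans ((measure_union_le _ _).trans ?_)
    rw [two_mul, ENNReal.ofReal_add (by positivity) (by positivity)]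
    refine add_le_add ((h₁ n).trans ?_) ((h₂ n).trans ?_)
    · exact ENNReal.ofReal_le_ofReal (pow_le_pow_left₀ hr₁.1.le (le_max_left _ _) n)
    · exact ENNReal.ofReal_le_ofReal (pow_le_pow_left₀ hr₂.1.le (le_max_right _ _) n)
  have hlow' : ENNReal.ofReal (c * ρ ^ n) ≤ P (treeSizeEvent ξ n) :=
    ENNReal.ofReal_le_of_le_toReal (by rw [hsize]; exact hlow n hn)
  calc (P (treeSizeEvent ξ n))⁻¹ * _
      ≤ (ENNReal.ofReal (c * ρ ^ n))⁻¹ * ENNReal.ofReal (2 * r ^ n) := by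
        gcongr
    _ = ENNReal.ofReal (2 / c * (r / ρ) ^ n) := by
        rw [← ENNReal.ofReal_inv_of_pos (by positivity), ← ENNReal.ofReal_mul (by positivity)]
        congr 1
        rw [div_pow]
        field_simp
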